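/- Let $n\ge 0$ be an integer, let $[n]=\{1,\dots,n\}$, and let $\langle X,Y\rangle=\mathrm{Tr}(X^*Y)$ be the trace inner product. For $m\ge 1$, index matrices acting on $(\mathbb C^n)^{\otimes m}$ by $[n]^m$. Let $\mathrm{BS}((\mathbb C^n)^{\otimes m})$ be the set of Hermitian matrices $\rho$ with $\rho_{\underline i,\underline j^{\sigma}}=\rho_{\underline i,\underline j}$ for all $\underline i,\underline j\in[n]^m$ and all permutations $\sigma$ of $[m]$, where $\underline j^\sigma=(j_{\sigma(1)},\dots,j_{\sigma(m)})$. For $t\ge 1$ call the first register of $\mathbb C^n\otimes(\mathbb C^n)^{\otimes t}$ the A-register and the other $t$ the B-registers. For a matrix $R$ acting on this space let $R^{T_{B[s]}}$ be its partial transpose with respect to the first $s$ B-registers, and let $\mathrm{Tr}_{B[2:t]}(R)$ be the matrix acting on $\mathbb C^n\otimes\mathbb C^n$ obtained by tracing out the last $t-1$ B-registers. Define $$\widetilde{\mathrm{DPS}}^{(t)}_n=\Big\{\rho\in\mathrm{Herm}(\mathbb C^n\otimes\mathbb C^n):\ \exists R\in \mathrm{BS}((\mathbb C^n)^{\otimes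 (t+1)}),\ R^{T_{B[s]}}\succeq 0\ \text{ for } s=0,1,\dots,\lfloor (t+1)/2\rfloor,\ \ \rho=\mathrm{Tr}_{B[2:t]}(R)\Big\}$$ and its dual cone $$(\widetilde{\mathrm{DPS}}^{(t)}_n)^*=\{N\in\mathrm{Herm}(\mathbb C^n\otimes\mathbb C^n):\ \langle N,\rho\rangle\ge 0\ \text{ for all }\rho\in\widetilde{\mathrm{DPS}}^{(t)}_n\}.$$ For $r\ge 0$ let $\mathcal K^{(r)}_n$ be the set of real symmetric $n\times n$ matrices $A$ for which the polynomial $$\Big(\sum_{i=1}^n x_i^2\Big)^{r}\ \sum_{i,j=1}^n A_{ij}\,x_i^2x_j^2\in\mathbb R[x_1,\dots,x_n]$$ is a sum of squares of real polynomials. For $S\in\mathbb R^{n\times n}$ and a Hermitian matrix $T\in\mathbb C^{n\times n}$ let $$M_{S,T}=\sum_{i,j=1}^n S_{ij}\,e_ie_i^*\otimes e_je_j^*+\sum_{i,j=1}^n T_{ij}\,e_je_i^*\otimes e_je_i^*,$$ and let $M_{S,T}^{T_B}$ be its partial transpose with respect to the second register, where $(\rho^{T_B})_{ih,jk}=\rho_{ik,jh}$;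 that is, $M_{S,T}^{T_B}=\sum_{i,j}S_{ij}\,e_ie_i^*\otimes e_je_j^*+\sum_{i,j}T_{ij}\,e_je_i^*\otimes e_ie_j^*$. **Theorem.** Let $S\in\mathbb R^{n\times n}$, let $T\in\mathbb C^{n\times n}$ be Hermitian, and set $A=(S+S^T+T+T^T)/2$. Then $A$ is a real symmetric matrix, and for every integer $t\ge 1$, $$M_{S,T}^{T_B}\in(\widetilde{\mathrm{DPS}}^{(t)}_n)^*\iff A\in\mathcal K^{(t-1)}_n.$$ In particular, for every real symmetric $n\times n$ matrix $A$ and every integer $t\ge 1$, $$M_{A,0}^{T_B}\in(\widetilde{\mathrm{DPS}}^{(t)}_n)^*\iff A\in\mathcal K^{(t-1)}_n.$$ -/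

import Mathlib

open scoped ComplexOrder Kronecker

namespace SymDPS

/-- The bipartite partial transpose with respect to the second register:
`(ρ^{T_B})_{ih,jk} = ρ_{ik,jh}`. -/
def partialTransposeB {n : ℕ} (ρ : Matrix (Fin n × Fin n) (Fin n × Fin n) ℂ) :
    Matrix (Fin n × Fin n) (Fin n × Fin n) ℂ :=
  Matrix.of fun p q => ρ (p.1, q.2) (q.1, p.2)

/-- The matrix
`M_{S,T} = ∑ S_ij e_i e_i^* ⊗ e_j e_j^* + ∑ T_ij e_j e_i^* ⊗ e_j e_i^*`. -/
noncomputable def M {n : ℕ} (S : Matrix (Fin n) (Fin n) ℝ) (T : Matrix (Fin n) (Fin n) ℂ) :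
    Matrix (Fin n × Fin n) (Fin n × Fin n) ℂ :=
  (∑ i, ∑ j, (S i j : ℂ) • (Matrix.single i i (1 : ℂ) ⊗ₖ Matrix.single j j (1 : ℂ)))
    + ∑ i, ∑ j, T i j • (Matrix.single j i (1 : ℂ) ⊗ₖ Matrix.single j i (1 : ℂ))

/-- Bose symmetric Hermitian matrices acting on `(ℂ^n)^{⊗ m}`. Registers are indexed by `Fin m`,
basis vectors by `Fin m → Fin n`, and the columns of `ρ` are invariant under permuting all
the registers: `ρ e_{i_1} ⊗ ⋯ ⊗ e_{i_m} = ρ e_{i_{σ(1)}} ⊗ ⋯ ⊗ e_{i_{σ(m)}}`. -/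
def boseSymmetric (n m : ℕ) : Set (Matrix (Fin m → Fin n) (Fin m → Fin n) ℂ) :=
  {ρ | ρ.IsHermitian ∧
    ∀ (σ : Equiv.Perm (Fin m)) (i j : Fin m → Fin n), ρ i (j ∘ σ) = ρ i j}

/-- `mixIndex s i j` is the index that agrees with `j` on the first `s` B-registers
(registers `1, …, s`; register `0` is the A-register) and with `i` elsewhere. -/
def mixIndex {n t : ℕ} (s : ℕ) (i j : Fin (t + 1) → Fin n) : Fin (t + 1) → Fin n :=
  fun k => if 1 ≤ (k : ℕ) ∧ (k : ℕ) ≤ s then j k else i k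

/-- The partial transpose `ρ^{T_{B[s]}}` with respect to the first `s` of the `t` B-registers. -/
def partialTranspose {n t : ℕ} (s : ℕ)
    (ρ : Matrix (Fin (t + 1) → Fin n) (Fin (t + 1) → Fin n) ℂ) :
    Matrix (Fin (t + 1) → Fin n) (Fin (t + 1) → Fin n) ℂ :=
  Matrix.of fun i j => ρ (mixIndex s i j) (mixIndex s j i)

/-- The concatenation of `p = (i₀, i₁)` and `u ∈ [n]^{t-1}`, an index in `[n]^{t+1}` when `1 ≤ t`. -/
def concatIndex {n t : ℕ} (p : Fin n × Fin n) (u : Fin (t - 1) → Fin n) :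
    Fin (t + 1) → Fin n :=
  fun k => if (k : ℕ) = 0 then p.1
    else if h : 2 ≤ (k : ℕ) then u ⟨(k : ℕ) - 2, by omega⟩
    else p.2

/-- The partial trace `Tr_{B[2:t]}`, tracing out the last `t - 1` B-registers. -/
def partialTrace {n t : ℕ} (ρ : Matrix (Fin (t + 1) → Fin n) (Fin (t + 1) → Fin n) ℂ) :
    Matrix (Fin n × Fin n) (Fin n × Fin n) ℂ :=
  Matrix.of fun p q => ∑ u : Fin (t - 1) → Fin n, ρ (concatIndex p u) (concatIndex q u)

/-- The relaxation of order `t` (for `1 ≤ t`) in the symmetric DPS hierarchy. -/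
def dpsTilde (n t : ℕ) : Set (Matrix (Fin n × Fin n) (Fin n × Fin n) ℂ) :=
  {ρ | ρ.IsHermitian ∧ ∃ R ∈ boseSymmetric n (t + 1),
    (∀ s : ℕ, s ≤ (t + 1) / 2 → (partialTranspose s R).PosSemidef) ∧
    ρ = partialTrace R}

/-- The dual cone, within the real space of Hermitian matrices, for the trace inner product
`⟨M, ρ⟩ = Tr(M^* ρ)` (which is real when `M` and `ρ` are Hermitian). -/
def dualCone {ι : Type*} [Fintype ι] (C : Set (Matrix ι ι ℂ)) : Set (Matrix ι ι ℂ) :=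
  {N | N.IsHermitian ∧ ∀ ρ ∈ C, 0 ≤ (Matrix.trace (N.conjTranspose * ρ)).re}

/-- The polynomial `f_A = ∑ A_ij x_i² x_j²`. -/
noncomputable def quarticForm {n : ℕ} (A : Matrix (Fin n) (Fin n) ℝ) :
    MvPolynomial (Fin n) ℝ :=
  ∑ i, ∑ j, MvPolynomial.C (A i j) * MvPolynomial.X i ^ 2 * MvPolynomial.X j ^ 2

/-- The cone `K^{(r)}_n` of symmetric matrices `A` for which `‖x‖^{2r} f_A` is a sum of squares of
real polynomials. -/
def coneK (n r : ℕ) : Set (Matrix (Fin n) (Fin n) ℝ) :=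
  {A | A.IsSymm ∧
    IsSumSq ((∑ i, (MvPolynomial.X i : MvPolynomial (Fin n) ℝ) ^ 2) ^ r * quarticForm A)}

end SymDPS

/-! Entries of a Bose symmetric `R` depend only on the `weight`s (exponent vectors) of row and
column. Hence pairing `M_{S,T}^{T_B}` with the partial trace of `R` sees only the diagonal of `R`,
and it equals `L (‖x‖^{2(t-1)} f_A)` for every linear `L` sending `x^{2 weight i}` to `R i i`
(`hpair`). If the polynomial is not a sum of squares, a separating `L` has a moment matrix `L
(x^{weight i + weight j})` that is Bose symmetric and fixed by every partial transpose, so it is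
feasible with negative pairing (`exists_separating_boseSymmetric`). Conversely, a feasible `R`
defines `evenFunctional R`, which vanishes on the other monomials. It is nonnegative on squares of
degree at most `2(t+1)`: its moment matrix splits by parity pattern, and each block is a submatrix
of one partial transpose of `R` (`sum_evenMoment_nonneg_of_parity`). -/

namespace SymDPS

/-! ### Closedness of linear images of cones, and separation. -/

section ClosedCone

variable {E F : Type*} [NormedAddCommGroup E] [NormedSpace ℝ E] [FiniteDimensional ℝ E]

/-- The image of a closed cone under a linear map whose kernel meets the cone trivially is
closed. -/
theorem isClosed_image_of_cone [NormedAddCommGroup F] [NormedSpace ℝ F] (G : E →ₗ[ℝ] F)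
    {C : Set E} (hC : IsClosed C) (hsmul : ∀ c : ℝ, 0 < c → ∀ x ∈ C, c • x ∈ C)
    (hker : ∀ x ∈ C, G x = 0 → x = 0) : IsClosed (G '' C) := by
  have hG : Continuous G := G.continuous_of_finiteDimensional
  have : ProperSpace E := FiniteDimensional.proper ℝ E
  -- `c` is the minimum of `‖G x‖` over the compact unit sphere of the cone; homogeneity extends the
  -- bound.
  obtain ⟨c, hc, hcb⟩ : ∃ c : ℝ, 0 < c ∧ ∀ x ∈ C, c * ‖x‖ ≤ ‖G x‖ := by
    have key : ∃ c : ℝ, 0 < c ∧ ∀ x ∈ C ∩ Metric.sphere 0 1, c ≤ ‖G x‖ := by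
      rcases (C ∩ Metric.sphere (0 : E) 1).eq_empty_or_nonempty with h | h
      · exact ⟨1, one_pos, by simp [h]⟩
      · obtain ⟨x, hx, hmin⟩ := ((isCompact_sphere (0 : E) 1).inter_left hC).exists_isMinOn h
          hG.norm.continuousOn
        refine ⟨‖G x‖, norm_pos_iff.2 fun h0 => ?_, fun y hy => hmin hy⟩
        have := hx.2
        simp [hker x hx.1 h0] at this
    obtain ⟨c, hc, hcb⟩ := key
    refine ⟨c, hc, fun x hx => ?_⟩
    rcases eq_or_ne x 0 with rfl | h0
    · simp
    have hpos : 0 < ‖x‖ := norm_pos_iff.2 h0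
    have h1 := hcb (‖x‖⁻¹ • x) ⟨hsmul _ (inv_pos.2 hpos) x hx, by
      simp [norm_smul, hpos.ne']⟩
    rw [map_smul, norm_smul, norm_inv, norm_norm, inv_mul_eq_div, le_div_iff₀ hpos] at h1
    exact h1
  refine isClosed_of_closure_subset fun y hy => ?_
  -- Preimages in `C` of points within distance 1 of `y` have norm at most `(‖y‖ + 1) / c`, so a
  -- compact piece of the cone suffices.
  have hcl : IsClosed (G '' (C ∩ Metric.closedBall 0 ((‖y‖ + 1) / c))) :=
    (((isCompact_closedBall _ _).inter_left hC).image hG).isClosed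
  refine Set.image_mono Set.inter_subset_left (hcl.closure_subset (Metric.mem_closure_iff.2 ?_))
  intro ε hε
  obtain ⟨_, ⟨x, hx, rfl⟩, hd⟩ := Metric.mem_closure_iff.1 hy (min ε 1) (lt_min hε one_pos)
  refine ⟨_, ⟨x, ⟨hx, ?_⟩, rfl⟩, hd.trans_le (min_le_left _ _)⟩
  rw [mem_closedBall_zero_iff, le_div_iff₀ hc, mul_comm]
  have h1 : dist y (G x) < 1 := hd.trans_le (min_le_right _ _)
  have h2 : ‖G x‖ ≤ ‖y‖ + dist y (G x) := by
    rw [dist_comm, dist_eq_norm]; exact norm_le_norm_add_norm_sub' _ _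
  linarith [hcb x hx]

/-- A point outside the image of a closed convex cone can be strictly separated from it, provided
the kernel of the linear map meets the cone trivially. -/
theorem exists_linearMap_nonneg_on_image_cone [AddCommGroup F] [Module ℝ F] (G : E →ₗ[ℝ] F)
    {C : Set E} (hC : IsClosed C) (hconv : Convex ℝ C) (h0 : (0 : E) ∈ C)
    (hsmul : ∀ c : ℝ, 0 < c → ∀ x ∈ C, c • x ∈ C)
    (hker : ∀ x ∈ C, G x = 0 → x = 0) {p : F} (hp : p ∉ G '' C) :
    ∃ L : F →ₗ[ℝ] ℝ, (∀ x ∈ C, 0 ≤ L (G x)) ∧ L p < 0 := by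
  -- `F` carries no topology and may be infinite-dimensional; the separation takes place in
  -- coordinates on the finite-dimensional `W`.
  let W : Submodule ℝ F := LinearMap.range G ⊔ Submodule.span ℝ {p}
  have hGW : ∀ x, G x ∈ W := fun x => Submodule.mem_sup_left ⟨x, rfl⟩
  have hpW : p ∈ W := Submodule.mem_sup_right (Submodule.mem_span_singleton_self p)
  let e := (Module.finBasis ℝ W).equivFun
  obtain ⟨π, hπ⟩ := LinearMap.exists_extend (e : W →ₗ[ℝ] (Fin (Module.finrank ℝ W) → ℝ))
  have hπW : ∀ x (hx : x ∈ W), π x = e ⟨x, hx⟩ := fun x hx => LinearMap.congr_fun hπ ⟨x, hx⟩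
  have hinj : ∀ x ∈ W, ∀ y ∈ W, π x = π y → x = y := fun x hx y hy h => by
    rw [hπW x hx, hπW y hy] at h
    exact congrArg Subtype.val (e.injective h)
  have hcl := isClosed_image_of_cone (π ∘ₗ G) hC hsmul fun x hx h =>
    hker x hx (hinj _ (hGW x) 0 W.zero_mem (by simpa using h))
  have hnot : π p ∉ (π ∘ₗ G) '' C := by
    rintro ⟨x, hx, h⟩
    exact hp ⟨x, hx, hinj _ (hGW x) _ hpW h⟩
  obtain ⟨φ, u, hu, hb⟩ := geometric_hahn_banach_point_closed (hconv.linear_image _) hcl hnot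
  have hu0 : u < 0 := by simpa using hb 0 ⟨0, h0, by simp⟩
  refine ⟨(φ : (Fin (Module.finrank ℝ W) → ℝ) →ₗ[ℝ] ℝ) ∘ₗ π, fun x hx => ?_, hu.trans hu0⟩
  by_contra! hneg
  have hneg' : φ (π (G x)) < 0 := hneg
  -- Scaling `x` by `u / φ (π (G x)) > 0` gives the value exactly `u`, against the strict bound.
  have := hb _ ⟨_, hsmul _ (div_pos_of_neg_of_neg hu0 hneg') x hx, rfl⟩
  simp [hneg'.ne] at this

end ClosedCone

/-! ### Gram matrices, separation from sums of squares, and degrees of the summands. -/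

section SumOfSquares

open MvPolynomial

variable {σ ι : Type*} [Fintype ι]

theorem isClosed_posSemidef : IsClosed {Q : ι → ι → ℝ | (Matrix.of Q).PosSemidef} := by
  have : {Q : ι → ι → ℝ | (Matrix.of Q).PosSemidef} =
      (⋂ i, ⋂ j, {Q | Q i j = Q j i}) ∩ ⋂ x : ι → ℝ, {Q | 0 ≤ ∑ i, x i * ∑ j, Q i j * x j} := by
    ext Q
    simp only [Matrix.posSemidef_iff_dotProduct_mulVec, dotProduct, Matrix.mulVec,
      Set.mem_ofPred_eq, Set.mem_inter_iff, Set.mem_iInter, Pi.star_apply, star_trivial,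
      Matrix.of_apply]
    refine and_congr_left fun _ => ⟨fun h i j => ?_, fun h => ?_⟩
    · simpa using (h.apply i j).symm
    · ext i j
      simpa using h j i
  rw [this]
  refine (isClosed_iInter fun i => isClosed_iInter fun j => ?_).inter (isClosed_iInter fun x => ?_)
  · exact isClosed_eq (by fun_prop) (by fun_prop)
  · exact isClosed_le (by fun_prop) (by fun_prop)

/-- The polynomial with Gram matrix `Q` in the monomials with exponents `b i`. -/
noncomputable def gramPolynomial (b : ι → σ →₀ ℕ) : (ι → ι → ℝ) →ₗ[ℝ] MvPolynomial σ ℝ :=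
  ∑ i, ∑ j, monomial (b i + b j) ∘ₗ LinearMap.proj j ∘ₗ LinearMap.proj i

theorem gramPolynomial_apply (b : ι → σ →₀ ℕ) (Q : ι → ι → ℝ) :
    gramPolynomial b Q = ∑ i, ∑ j, monomial (b i + b j) (Q i j) := by
  simp [gramPolynomial, LinearMap.sum_apply]

theorem gramPolynomial_sum_vecMulVec (b : ι → σ →₀ ℕ) {m : ℕ} (v : Fin m → ι → ℝ) :
    gramPolynomial b (∑ k, fun i j => v k i * v k j) =
      ∑ k, (∑ i, monomial (b i) (v k i)) ^ 2 := by
  rw [map_sum]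
  refine Finset.sum_congr rfl fun k _ => ?_
  simp_rw [gramPolynomial_apply, sq, Finset.sum_mul_sum, monomial_mul]

theorem eq_zero_of_sum_sq_eq_zero {m : ℕ} {q : Fin m → MvPolynomial σ ℝ}
    (h : ∑ k, q k ^ 2 = 0) (k : Fin m) : q k = 0 := by
  refine funext fun x => ?_
  have hx := congrArg (eval x) h
  simp only [map_sum, map_pow, map_zero] at hx ⊢
  exact pow_eq_zero_iff two_ne_zero |>.1
    ((Finset.sum_eq_zero_iff_of_nonneg fun _ _ => sq_nonneg _).1 hx k (Finset.mem_univ k))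

theorem exists_eq_sum_vecMulVec {Q : ι → ι → ℝ} (hQ : (Matrix.of Q).PosSemidef) :
    ∃ (m : ℕ) (v : Fin m → ι → ℝ), Q = ∑ k, fun i j => v k i * v k j := by
  obtain ⟨m, v, hv⟩ := Matrix.posSemidef_iff_eq_sum_vecMulVec.1 hQ
  refine ⟨m, v, ?_⟩
  ext i j
  have := congrFun (congrFun hv i) j
  simpa [Matrix.sum_apply, Matrix.vecMulVec_apply, Finset.sum_apply] using this

/-- A polynomial that is not a sum of squares is strictly separated from the sums of squares of
polynomials supported on finitely many given monomials. -/
theorem exists_linearMap_of_not_isSumSq {b : ι → σ →₀ ℕ} (hb : Function.Injective b)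
    {p : MvPolynomial σ ℝ} (hp : ¬ IsSumSq p) :
    ∃ L : MvPolynomial σ ℝ →ₗ[ℝ] ℝ, L p < 0 ∧
      (Matrix.of fun i j => L (monomial (b i + b j) 1)).PosSemidef := by
  -- A vanishing sum of real squares has zero terms, and injectivity of `b` recovers the
  -- coefficients from each term.
  have hker : ∀ Q ∈ {Q : ι → ι → ℝ | (Matrix.of Q).PosSemidef},
      gramPolynomial b Q = 0 → Q = 0 := by
    intro Q hQ h
    obtain ⟨m, v, rfl⟩ := exists_eq_sum_vecMulVec hQ
    rw [gramPolynomial_sum_vecMulVec] at h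
    have hv : v = 0 := by
      ext k i
      have := congrArg (coeff (b i)) (eq_zero_of_sum_sq_eq_zero h k)
      classical
      simpa [coeff_sum, coeff_monomial, hb.eq_iff] using this
    ext i j
    simp [hv]
  have hp' : p ∉ gramPolynomial b '' {Q : ι → ι → ℝ | (Matrix.of Q).PosSemidef} := by
    rintro ⟨Q, hQ, rfl⟩
    obtain ⟨m, v, rfl⟩ := exists_eq_sum_vecMulVec hQ
    rw [gramPolynomial_sum_vecMulVec] at hp
    exact hp (IsSumSq.sum_sq _ _)
  obtain ⟨L, hL, hLp⟩ := exists_linearMap_nonneg_on_image_cone (gramPolynomial b)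
    isClosed_posSemidef
    (fun Q hQ Q' hQ' a c ha hc _ =>
      (Matrix.PosSemidef.smul hQ ha).add (Matrix.PosSemidef.smul hQ' hc))
    Matrix.PosSemidef.zero (fun c hc Q hQ => Matrix.PosSemidef.smul hQ hc.le) hker hp'
  refine ⟨L, hLp, Matrix.PosSemidef.of_dotProduct_mulVec_nonneg ?_ fun x => ?_⟩
  · ext i j
    simp [add_comm]
  -- Evaluating `L` on the rank-one Gram matrix of `x` yields the quadratic form at `x`.
  · have hx : (Matrix.of fun i j => x i * x j).PosSemidef := by
      have h := Matrix.posSemidef_vecMulVec_self_star x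
      rw [star_trivial] at h
      exact h
    refine (hL _ hx).trans_eq ?_
    simp only [gramPolynomial_apply, map_sum, dotProduct, Matrix.mulVec, Finset.mul_sum,
      Pi.star_apply, star_trivial, Matrix.of_apply]
    refine Finset.sum_congr rfl fun i _ => Finset.sum_congr rfl fun j _ => ?_
    rw [← mul_one (x i * x j), ← smul_eq_mul (x i * x j) (1 : ℝ), ← smul_monomial, map_smul,
      smul_eq_mul]
    ring

/-- Leading coefficients of sums of squares are nonnegative, so squares cannot cancel. -/
theorem totalDegree_mul_self_le {n : ℕ} {p s : MvPolynomial (Fin n) ℝ} (hs : IsSumSq s) :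
    (p * p).totalDegree ≤ (p * p + s).totalDegree ∧ s.totalDegree ≤ (p * p + s).totalDegree := by
  let o : MonomialOrder (Fin n) := MonomialOrder.degLex
  have add : ∀ f g : MvPolynomial (Fin n) ℝ, 0 ≤ o.leadingCoeff f → 0 ≤ o.leadingCoeff g →
      0 ≤ o.leadingCoeff (f + g) ∧ o.toSyn (o.degree f) ≤ o.toSyn (o.degree (f + g)) ∧
        o.toSyn (o.degree g) ≤ o.toSyn (o.degree (f + g)) := by
    intro f g hf hg
    rcases lt_trichotomy (o.toSyn (o.degree f)) (o.toSyn (o.degree g)) with h | h | h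
    · rw [add_comm f g, o.degree_add_of_lt h, o.leadingCoeff_add_of_lt h]
      exact ⟨hg, h.le, le_rfl⟩
    · have hd := o.toSyn.injective h
      have hc : (f + g).coeff (o.degree f) = o.leadingCoeff f + o.leadingCoeff g := by
        rw [coeff_add, MonomialOrder.leadingCoeff, MonomialOrder.leadingCoeff, hd]
      by_cases hz : (f + g).coeff (o.degree f) = 0
      · have h1 : f = 0 := o.leadingCoeff_eq_zero_iff.1 (by linarith)
        have h2 : g = 0 := o.leadingCoeff_eq_zero_iff.1 (by linarith)
        simp [h1, h2]
      · have hle : o.toSyn (o.degree f) ≤ o.toSyn (o.degree (f + g)) :=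
          o.le_degree (mem_support_iff.2 hz)
        have heq : o.degree (f + g) = o.degree f := o.toSyn.injective <| le_antisymm
          (o.degree_add_le.trans (by rw [h, max_self])) hle
        refine ⟨?_, hle, h ▸ hle⟩
        rw [MonomialOrder.leadingCoeff, heq, hc]
        exact add_nonneg hf hg
    · rw [o.degree_add_of_lt h, o.leadingCoeff_add_of_lt h]
      exact ⟨hf, le_rfl, h.le⟩
  have hsq : ∀ f : MvPolynomial (Fin n) ℝ, 0 ≤ o.leadingCoeff (f * f) := fun f => by
    rw [o.leadingCoeff_mul]; exact mul_self_nonneg _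
  have hs' : 0 ≤ o.leadingCoeff s := by
    induction hs with
    | zero => simp
    | sq_add a _ ih => exact (add _ _ (hsq a) ih).1
  obtain ⟨-, h1, h2⟩ := add _ _ (hsq p) hs'
  exact ⟨degLex_totalDegree_monotone h1, degLex_totalDegree_monotone h2⟩

end SumOfSquares

/-! ### Exponent vectors of register indices. -/

section Weight

variable {n : ℕ} {κ : Type*} [Fintype κ]

/-- The exponent vector of the monomial `∏ k, x_{i k}`. -/
noncomputable def weight (i : κ → Fin n) : Fin n →₀ ℕ := ∑ k, Finsupp.single (i k) 1

theorem weight_apply (i : κ → Fin n) (a : Fin n) :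
    weight i a = Fintype.card {k // i k = a} := by
  classical
  simp [weight, Finsupp.finsetSum_apply, Finsupp.single_apply, Fintype.card_subtype]

theorem exists_perm_of_weight_eq {i j : κ → Fin n} (h : weight i = weight j) :
    ∃ σ : Equiv.Perm κ, i = j ∘ σ := by
  have hc : ∀ a, Fintype.card {k // i k = a} = Fintype.card {k // j k = a} := fun a => by
    rw [← weight_apply, ← weight_apply, h]
  refine ⟨Equiv.ofFiberEquiv fun a => Fintype.equivOfCardEq (hc a), funext fun k => ?_⟩
  exact (Equiv.ofFiberEquiv_map _ k).symm

theorem degree_weight (i : κ → Fin n) : (weight i).degree = Fintype.card κ := by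
  simp [weight, map_sum]

omit [Fintype κ] in
-- Peel one variable off `α` for each element of `K`; `f₀` only supplies values outside `K`.
theorem exists_sum_single_eq (K : Finset κ) {α : Fin n →₀ ℕ} (hα : α.degree = K.card)
    (f₀ : κ → Fin n) : ∃ f : κ → Fin n, ∑ k ∈ K, Finsupp.single (f k) 1 = α := by
  classical
  induction K using Finset.induction_on generalizing α with
  | empty => exact ⟨f₀, by simpa using ((Finsupp.degree_eq_zero_iff α).1 hα).symm⟩
  | insert k K hk ih =>
    rw [Finset.card_insert_of_notMem hk] at hα
    obtain ⟨a, ha⟩ : ∃ a, α a ≠ 0 := by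
      by_contra! h
      have : α = 0 := Finsupp.ext h
      simp [this] at hα
    have hle : Finsupp.single a 1 ≤ α := by
      rw [Finsupp.single_le_iff]; omega
    obtain ⟨β, rfl⟩ := exists_add_of_le hle
    obtain ⟨f, hf⟩ := ih (α := β) (by simp at hα; omega)
    refine ⟨Function.update f k a, ?_⟩
    rw [Finset.sum_insert hk, Function.update_self]
    congr 1
    rw [← hf]
    refine Finset.sum_congr rfl fun l hl => ?_
    rw [Function.update_of_ne (ne_of_mem_of_not_mem hl hk)]

/-- Equal weights differ by a permutation; hermiticity carries the column invariance over to rows.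
-/
theorem boseSymmetric_apply_congr {m : ℕ} {R : Matrix (Fin m → Fin n) (Fin m → Fin n) ℂ}
    (hR : R ∈ boseSymmetric n m) {i i' j j' : Fin m → Fin n} (hi : weight i = weight i')
    (hj : weight j = weight j') : R i j = R i' j' := by
  obtain ⟨σ, rfl⟩ := exists_perm_of_weight_eq hi
  obtain ⟨τ, rfl⟩ := exists_perm_of_weight_eq hj
  rw [hR.2, ← hR.1.apply, hR.2, hR.1.apply]

theorem weight_concatIndex {r : ℕ} (p : Fin n × Fin n) (u : Fin r → Fin n) :
    weight (concatIndex (t := r + 1) p u) =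
      Finsupp.single p.1 1 + Finsupp.single p.2 1 + weight u := by
  rw [weight, Fin.sum_univ_succ, Fin.sum_univ_succ, ← add_assoc]
  rfl

theorem weight_mixIndex_add {t : ℕ} (s : ℕ) (i j : Fin (t + 1) → Fin n) :
    weight (mixIndex s i j) + weight (mixIndex s j i) = weight i + weight j := by
  simp only [weight, ← Finset.sum_add_distrib]
  refine Finset.sum_congr rfl fun k _ => ?_
  simp only [mixIndex]
  split_ifs
  · exact add_comm _ _
  · rfl

end Weight

/-! ### The pairing as a functional applied to `‖x‖^{2r} f_A`. -/

section Pairing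

open MvPolynomial

variable {n : ℕ}

theorem linearMap_sum_sq_pow_mul_quarticForm (L : MvPolynomial (Fin n) ℝ →ₗ[ℝ] ℝ)
    (A : Matrix (Fin n) (Fin n) ℝ) (r : ℕ) :
    L ((∑ i, (X i : MvPolynomial (Fin n) ℝ) ^ 2) ^ r * quarticForm A) =
      ∑ i, ∑ j, A i j * ∑ u : Fin r → Fin n, L (monomial
        (weight (concatIndex (t := r + 1) (i, j) u) + weight (concatIndex (t := r + 1) (i, j) u))
        1) := by
  have hu : ∀ u : Fin r → Fin n,
      ∏ k, (X (u k) : MvPolynomial (Fin n) ℝ) ^ 2 = monomial (weight u + weight u) 1 := fun u => by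
    rw [Finset.prod_pow, weight, ← one_mul (1 : ℝ), ← monomial_mul, monomial_sum_one, sq]
    rfl
  rw [Finset.sum_pow', Fintype.piFinset_univ, quarticForm, Finset.mul_sum, map_sum]
  refine Finset.sum_congr rfl fun i _ => ?_
  rw [Finset.mul_sum, map_sum]
  refine Finset.sum_congr rfl fun j _ => ?_
  rw [Finset.sum_mul, map_sum, Finset.mul_sum]
  refine Finset.sum_congr rfl fun u _ => ?_
  rw [← smul_eq_mul (A i j), ← map_smul]
  congr 1
  rw [hu, weight_concatIndex, smul_eq_C_mul, mul_assoc (C (A i j)), mul_left_comm]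
  congr 1
  simp only [X, sq, monomial_mul, mul_one]
  congr 2
  abel

theorem partialTransposeB_M_apply (S : Matrix (Fin n) (Fin n) ℝ) (T : Matrix (Fin n) (Fin n) ℂ)
    (a b c d : Fin n) : partialTransposeB (M S T) (a, b) (c, d) =
      (if a = c ∧ b = d then (S a b : ℂ) else 0) + if a = d ∧ b = c then T b a else 0 := by
  simp only [partialTransposeB, M, Matrix.of_apply, Matrix.add_apply, Matrix.sum_apply,
    Matrix.smul_apply, Matrix.kronecker_apply, Matrix.single_apply, smul_eq_mul]
  congr 1
  · rw [Finset.sum_eq_single a, Finset.sum_eq_single d]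
    · by_cases h1 : a = c <;> by_cases h2 : b = d <;> simp [h1, h2, eq_comm]
    · intro j _ hj; simp [hj]
    · simp
    · intro j _ hj; simp [hj]
    · simp
  · rw [Finset.sum_eq_single c, Finset.sum_eq_single a]
    · by_cases h1 : a = d <;> by_cases h2 : b = c <;> simp [h1, h2, eq_comm]
    · intro j _ hj; simp [hj]
    · simp
    · intro j _ hj; simp [hj]
    · simp

theorem isHermitian_partialTransposeB_M (S : Matrix (Fin n) (Fin n) ℝ)
    {T : Matrix (Fin n) (Fin n) ℂ} (hT : T.IsHermitian) :
    (partialTransposeB (M S T)).IsHermitian := by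
  ext ⟨a, b⟩ ⟨c, d⟩
  rw [Matrix.conjTranspose_apply, partialTransposeB_M_apply, partialTransposeB_M_apply, star_add]
  congr 1
  · by_cases h : a = c ∧ b = d
    · simp [h]
    · rw [if_neg h, if_neg (by tauto), star_zero]
  · by_cases h : a = d ∧ b = c
    · obtain ⟨rfl, rfl⟩ := h
      simpa using hT.apply b a
    · rw [if_neg h, if_neg (by tauto), star_zero]

theorem partialTrace_isHermitian {t : ℕ}
    {R : Matrix (Fin (t + 1) → Fin n) (Fin (t + 1) → Fin n) ℂ} (hR : R.IsHermitian) :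
    (partialTrace R).IsHermitian := by
  ext p q
  simp [partialTrace, Matrix.conjTranspose_apply, hR.apply]

/-- The pairing of `M_{S,T}^{T_B}` with the partial trace of a Bose symmetric matrix depends only
on the diagonal of that matrix. -/
theorem trace_partialTransposeB_M_mul_partialTrace {r : ℕ} (S : Matrix (Fin n) (Fin n) ℝ)
    {T : Matrix (Fin n) (Fin n) ℂ} (hT : T.IsHermitian)
    {R : Matrix (Fin (r + 2) → Fin n) (Fin (r + 2) → Fin n) ℂ}
    (hR : R ∈ boseSymmetric n (r + 2)) :
    (Matrix.trace ((partialTransposeB (M S T)).conjTranspose * partialTrace (t := r + 1) R)).re =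
      ∑ i, ∑ j, ((S i j + S j i) / 2 + (T i j).re) * ∑ u : Fin r → Fin n,
        (R (concatIndex (t := r + 1) (i, j) u) (concatIndex (t := r + 1) (i, j) u)).re := by
  set D : Fin n → Fin n → ℝ := fun i j => ∑ u : Fin r → Fin n,
        (R (concatIndex (t := r + 1) (i, j) u) (concatIndex (t := r + 1) (i, j) u)).re with hD
  have hw : ∀ (a b : Fin n) (u : Fin r → Fin n), weight (concatIndex (t := r + 1) (a, b) u) =
      weight (concatIndex (t := r + 1) (b, a) u) := fun a b u => by
    rw [weight_concatIndex, weight_concatIndex, add_comm (Finsupp.single a 1)]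
  have hDsymm : ∀ i j, D i j = D j i := fun i j => Finset.sum_congr rfl fun u _ => by
    rw [boseSymmetric_apply_congr hR (hw i j u) (hw i j u)]
  have h1 : ∀ a b, partialTrace (t := r + 1) R (a, b) (a, b) = (D a b : ℂ) := fun a b => by
    simp only [partialTrace, Matrix.of_apply, hD, Complex.ofReal_sum]
    refine Finset.sum_congr rfl fun u _ => ?_
    exact (Complex.conj_eq_iff_re.1 (hR.1.apply _ _)).symm
  -- Swapping the first two registers keeps the weight, so the entries paired with `T` are also
  -- diagonal sums.
  have h2 : ∀ a b, partialTrace (t := r + 1) R (a, b) (b, a) = (D a b : ℂ) := fun a b => by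
    rw [← h1]
    simp only [partialTrace, Matrix.of_apply]
    exact Finset.sum_congr rfl fun u _ => boseSymmetric_apply_congr hR rfl (hw b a u)
  have htr : Matrix.trace ((partialTransposeB (M S T)).conjTranspose *
      partialTrace (t := r + 1) R) = ∑ a, ∑ b, ((S a b : ℂ) + T b a) * D a b := by
    rw [(isHermitian_partialTransposeB_M S hT).eq]
    simp only [Matrix.trace, Matrix.diag_apply, Matrix.mul_apply, Fintype.sum_prod_type,
      partialTransposeB_M_apply, add_mul, Finset.sum_add_distrib, ite_mul, zero_mul, ite_and,
      Finset.sum_ite_eq, Finset.mem_univ, if_true]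
    simp [Finset.sum_ite_eq, h1, h2, hDsymm]
  have hre : ∀ a b, (((S a b : ℂ) + T b a) * D a b).re = (S a b + (T a b).re) * D a b :=
    fun a b => by
      rw [Complex.re_mul_ofReal, Complex.add_re, Complex.ofReal_re, ← hT.apply b a]
      simp
  have hS : ∑ a, ∑ b, S a b * D a b = ∑ a, ∑ b, S b a * D a b := by
    rw [Finset.sum_comm]
    exact Finset.sum_congr rfl fun a _ => Finset.sum_congr rfl fun b _ => by rw [hDsymm]
  calc _ = ∑ a, ∑ b, (S a b + (T a b).re) * D a b := by
        simp only [htr, Complex.re_sum, hre]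
    _ = ∑ a, ∑ b, ((S a b + S b a) / 2 + (T a b).re) * D a b := by
        simp only [add_mul, add_div, Finset.sum_add_distrib, div_mul_eq_mul_div,
          ← Finset.sum_div, ← hS, add_halves]

end Pairing

/-! ### Feasible points from separating functionals. -/

open MvPolynomial

variable {n : ℕ}

theorem map_ofReal_posSemidef {ι : Type*} [Fintype ι] {Q : ι → ι → ℝ}
    (hQ : (Matrix.of Q).PosSemidef) : (Matrix.of fun i j => (Q i j : ℂ)).PosSemidef := by
  obtain ⟨m, v, rfl⟩ := exists_eq_sum_vecMulVec hQ
  refine Matrix.posSemidef_iff_eq_sum_vecMulVec.2 ⟨m, fun k i => (v k i : ℂ), ?_⟩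
  ext i j
  simp [Matrix.sum_apply, Matrix.vecMulVec_apply, Finset.sum_apply]

/-- Every polynomial that is not a sum of squares is separated from the sums of squares by the
moments of a feasible point of the relaxation. -/
theorem exists_separating_boseSymmetric {p : MvPolynomial (Fin n) ℝ} (hp : ¬ IsSumSq p) (t : ℕ) :
    ∃ L : MvPolynomial (Fin n) ℝ →ₗ[ℝ] ℝ, L p < 0 ∧ ∃ R ∈ boseSymmetric n (t + 1),
      (∀ s, (partialTranspose s R).PosSemidef) ∧
        ∀ i, L (monomial (weight i + weight i) 1) = (R i i).re := by
  let b : Set.range (weight : (Fin (t + 1) → Fin n) → Fin n →₀ ℕ) → Fin n →₀ ℕ := Subtype.val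
  have := Fintype.ofFinite (Set.range (weight : (Fin (t + 1) → Fin n) → Fin n →₀ ℕ))
  obtain ⟨L, hL, hpsd⟩ := exists_linearMap_of_not_isSumSq (b := b) Subtype.val_injective hp
  let R : Matrix (Fin (t + 1) → Fin n) (Fin (t + 1) → Fin n) ℂ :=
    Matrix.of fun i j => (L (monomial (weight i + weight j) 1) : ℂ)
  have hR : R.PosSemidef :=
    (map_ofReal_posSemidef hpsd).submatrix fun i => ⟨weight i, Set.mem_range_self i⟩
  refine ⟨L, hL, R, ⟨hR.1, fun σ i j => ?_⟩, fun s => ?_, fun i => by simp [R]⟩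
  · have : weight (j ∘ σ) = weight j := Equiv.sum_comp σ fun k => Finsupp.single (j k) 1
    simp [R, this]
  -- Partial transposition preserves the sum of row and column weights, on which alone `R` depends.
  · have : partialTranspose s R = R := by
      ext i j
      simp [partialTranspose, R, weight_mixIndex_add]
    rwa [this]

/-! ### Functionals from feasible points. -/

section Moment

variable {t : ℕ} (R : Matrix (Fin (t + 1) → Fin n) (Fin (t + 1) → Fin n) ℂ)

open Classical in
/-- The moment sequence that assigns the diagonal entries of `R` to the squares of monomials. -/
noncomputable def evenMoment (δ : Fin n →₀ ℕ) : ℝ :=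
  if h : ∃ i : Fin (t + 1) → Fin n, weight i + weight i = δ then (R h.choose h.choose).re else 0

/-- The linear functional with moments `evenMoment R`. -/
noncomputable def evenFunctional : MvPolynomial (Fin n) ℝ →ₗ[ℝ] ℝ :=
  (basisMonomials (Fin n) ℝ).constr ℝ (evenMoment R)

theorem evenFunctional_monomial (δ : Fin n →₀ ℕ) (c : ℝ) :
    evenFunctional R (monomial δ c) = c * evenMoment R δ := by
  have h : evenFunctional R (monomial δ 1) = evenMoment R δ := by
    have := (basisMonomials (Fin n) ℝ).constr_basis ℝ (evenMoment R) δ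
    rwa [coe_basisMonomials] at this
  rw [← mul_one c, ← smul_eq_mul c (1 : ℝ), ← smul_monomial, map_smul, h, smul_eq_mul,
    smul_eq_mul, mul_one]

theorem evenMoment_eq_zero {δ : Fin n →₀ ℕ}
    (h : ∀ i : Fin (t + 1) → Fin n, weight i + weight i ≠ δ) : evenMoment R δ = 0 := by
  rw [evenMoment, dif_neg (by simpa using h)]

variable {R}

/-- Doubling is injective on exponents, so the chosen index has the weight of `i` and the choice is
immaterial. -/
theorem evenMoment_weight_add_weight (hR : R ∈ boseSymmetric n (t + 1))
    (i : Fin (t + 1) → Fin n) : evenMoment R (weight i + weight i) = (R i i).re := by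
  have h : ∃ j : Fin (t + 1) → Fin n, weight j + weight j = weight i + weight i := ⟨i, rfl⟩
  have hw : weight h.choose = weight i := by
    ext a
    have := DFunLike.congr_fun h.choose_spec a
    simp only [Finsupp.add_apply] at this
    omega
  rw [evenMoment, dif_pos h, boseSymmetric_apply_congr hR hw hw]

/-- The parity pattern of an exponent vector. -/
noncomputable def parity (α : Fin n →₀ ℕ) : Fin n →₀ ℕ := α.mapRange (· % 2) rfl

theorem exists_eq_parity_add (α : Fin n →₀ ℕ) : ∃ β, α = parity α + (β + β) := by
  refine ⟨α.mapRange (· / 2) rfl, Finsupp.ext fun a => ?_⟩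
  simp only [parity, Finsupp.add_apply, Finsupp.mapRange_apply]
  omega

/-- The first `s` of the `t` B-registers. -/
def firstB (t s : ℕ) : Finset (Fin (t + 1)) := {k | 1 ≤ (k : ℕ) ∧ (k : ℕ) ≤ s}

theorem mem_firstB {s : ℕ} {k : Fin (t + 1)} : k ∈ firstB t s ↔ 1 ≤ (k : ℕ) ∧ (k : ℕ) ≤ s := by
  simp [firstB]

theorem card_firstB {s : ℕ} (hs : s ≤ t) : (firstB t s).card = s := by
  have : (firstB t s).map Fin.valEmbedding = Finset.Icc 1 s := by
    ext k
    simp only [Finset.mem_map, mem_firstB, Fin.valEmbedding_apply, Finset.mem_Icc]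
    exact ⟨fun ⟨l, hl, h⟩ => h ▸ hl, fun h => ⟨⟨k, by omega⟩, h, rfl⟩⟩
  rw [← Finset.card_map Fin.valEmbedding, this, Nat.card_Icc, Nat.add_sub_cancel]

/-- Indices can be distributed so that the first `s` B-registers carry the weight `β` and the
others the weight `α`. -/
theorem exists_index_of_weights {s : ℕ} (hs : s ≤ t) {α β : Fin n →₀ ℕ} (hβ : β.degree = s)
    (hα : α.degree = t + 1 - s) :
    ∃ i : Fin (t + 1) → Fin n, ∑ k ∈ firstB t s, Finsupp.single (i k) 1 = β ∧
      ∑ k ∈ (firstB t s)ᶜ, Finsupp.single (i k) 1 = α := by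
  have hn : 0 < n := by
    rcases n.eq_zero_or_pos with rfl | h
    · have : α = 0 := Subsingleton.elim _ _
      simp [this] at hα
      omega
    · exact h
  have hc := card_firstB hs
  obtain ⟨f, hf⟩ := exists_sum_single_eq (firstB t s) (hβ.trans hc.symm) fun _ => ⟨0, hn⟩
  obtain ⟨g, hg⟩ := exists_sum_single_eq (firstB t s)ᶜ (α := α)
    (by rw [Finset.card_compl, hc, Fintype.card_fin, hα]) fun _ => ⟨0, hn⟩
  refine ⟨fun k => if k ∈ firstB t s then f k else g k, ?_, ?_⟩
  · rw [← hf]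
    exact Finset.sum_congr rfl fun k hk => by simp only [if_pos hk]
  · rw [← hg]
    exact Finset.sum_congr rfl fun k hk => by simp only [if_neg (Finset.mem_compl.1 hk)]

theorem weight_mixIndex (s : ℕ) (i j : Fin (t + 1) → Fin n) :
    weight (mixIndex s i j) = ∑ k ∈ firstB t s, Finsupp.single (j k) 1 +
      ∑ k ∈ (firstB t s)ᶜ, Finsupp.single (i k) 1 := by
  rw [weight, ← Finset.sum_add_sum_compl (firstB t s)]
  congr 1
  · exact Finset.sum_congr rfl fun k hk => by simp only [mixIndex, if_pos (mem_firstB.1 hk)]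
  · exact Finset.sum_congr rfl fun k hk => by
      simp only [mixIndex, if_neg (mt mem_firstB.2 (Finset.mem_compl.1 hk))]

/-- On exponents of degree `t + 1` with a common parity pattern `a`, the even moments form a
submatrix of a partial transpose of `R`. -/
theorem sum_evenMoment_nonneg_of_parity (ht : 1 ≤ t) (hR : R ∈ boseSymmetric n (t + 1))
    (hpsd : ∀ s, s ≤ (t + 1) / 2 → (partialTranspose s R).PosSemidef)
    (F : Finset (Fin n →₀ ℕ)) (a : Fin n →₀ ℕ) (hdeg : ∀ α ∈ F, α.degree = t + 1)
    (hpar : ∀ α ∈ F, parity α = a) (c : (Fin n →₀ ℕ) → ℝ) :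
    0 ≤ ∑ α ∈ F, ∑ β ∈ F, c α * c β * evenMoment R (α + β) := by
  have hhalf : ∀ α : F, ∃ β, α.1 = a + (β + β) := fun α => by
    have := exists_eq_parity_add α.1
    rwa [hpar α.1 α.2] at this
  choose h hh using hhalf
  -- This is the common degree of the halves `h α`, and is at most `(t + 1) / 2`.
  set s := (t + 1 - a.degree) / 2 with hs
  have hd : ∀ α : F, a.degree + ((h α).degree + (h α).degree) = t + 1 := fun α => by
    rw [← map_add, ← map_add, ← hh, hdeg _ α.2]
  have hi : ∀ α : F, ∃ i : Fin (t + 1) → Fin n,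
      ∑ k ∈ firstB t s, Finsupp.single (i k) 1 = h α ∧
      ∑ k ∈ (firstB t s)ᶜ, Finsupp.single (i k) 1 = a + h α := fun α => by
    have := hd α
    exact exists_index_of_weights (by omega) (by omega) (by rw [map_add]; omega)
  choose e he1 he2 using hi
  -- Put `h α` on the first `s` B-registers and `a + h α` on the rest. Transposing those registers
  -- gives row and column the same weight `a + h α + h β`, half of `α + β`.
  have hentry : ∀ α β : F, evenMoment R (α.1 + β.1) = (partialTranspose s R (e α) (e β)).re := by
    intro α β
    have hw : ∀ α β, weight (mixIndex s (e α) (e β)) = h β + (a + h α) := fun α β => by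
      rw [weight_mixIndex, he1, he2]
    have hw' : weight (mixIndex s (e β) (e α)) = weight (mixIndex s (e α) (e β)) := by
      rw [hw, hw]; abel
    have hsum : α.1 + β.1 =
        weight (mixIndex s (e α) (e β)) + weight (mixIndex s (e α) (e β)) := by
      rw [hw, hh α, hh β]; abel
    rw [hsum, evenMoment_weight_add_weight hR, partialTranspose, Matrix.of_apply,
      boseSymmetric_apply_congr hR rfl hw']
  have hnn := ((hpsd s (by omega)).submatrix e).dotProduct_mulVec_nonneg fun α => (c α.1 : ℂ)
  have hre := (Complex.le_def.1 hnn).1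
  rw [Complex.zero_re] at hre
  refine hre.trans_eq ?_
  rw [← Finset.sum_coe_sort F]
  simp only [dotProduct, Matrix.mulVec, Complex.re_sum, Finset.mul_sum]
  refine Finset.sum_congr rfl fun α _ => ?_
  rw [← Finset.sum_coe_sort F]
  refine Finset.sum_congr rfl fun β _ => ?_
  rw [hentry]
  simp
  ring

/-- Only exponents of degree `t + 1` contribute, and pairs of different parity have zero moment, so
the form is a sum over parity classes. -/
theorem evenFunctional_mul_self_nonneg (ht : 1 ≤ t) (hR : R ∈ boseSymmetric n (t + 1))
    (hpsd : ∀ s, s ≤ (t + 1) / 2 → (partialTranspose s R).PosSemidef)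
    {q : MvPolynomial (Fin n) ℝ} (hq : q.totalDegree ≤ t + 1) :
    0 ≤ evenFunctional R (q * q) := by
  set F := q.support.filter fun α => α.degree = t + 1 with hF
  have hle : ∀ α ∈ q.support, α.degree ≤ t + 1 := fun α hα =>
    (le_totalDegree hα).trans hq
  have hzero : ∀ α β : Fin n →₀ ℕ, α.degree + β.degree ≠ 2 * (t + 1) →
      evenMoment R (α + β) = 0 := fun α β hne => evenMoment_eq_zero R fun i hi => hne <| by
    have := congrArg Finsupp.degree hi
    rw [map_add, map_add, degree_weight, Fintype.card_fin] at this
    omega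
  have hpar : ∀ α β : Fin n →₀ ℕ, parity α ≠ parity β → evenMoment R (α + β) = 0 :=
    fun α β hne => evenMoment_eq_zero R fun i hi => hne <| Finsupp.ext fun a => by
      have := DFunLike.congr_fun hi a
      simp only [Finsupp.add_apply, parity, Finsupp.mapRange_apply] at this ⊢
      omega
  have hexp : evenFunctional R (q * q) = ∑ α ∈ q.support, ∑ β ∈ q.support,
      coeff α q * coeff β q * evenMoment R (α + β) := by
    conv_lhs => rw [q.as_sum, Finset.sum_mul_sum]
    simp only [map_sum, monomial_mul, evenFunctional_monomial]
  have hres : evenFunctional R (q * q) = ∑ α ∈ F, ∑ β ∈ F,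
      coeff α q * coeff β q * evenMoment R (α + β) := by
    rw [hexp]
    refine (Finset.sum_subset (Finset.filter_subset _ _) fun α hα hα' =>
      Finset.sum_eq_zero fun β hβ => ?_).symm.trans (Finset.sum_congr rfl fun α hα =>
        (Finset.sum_subset (Finset.filter_subset _ _) fun β hβ hβ' => ?_).symm)
    · have h1 := hle α hα
      have h2 := hle β hβ
      have h3 : α.degree ≠ t + 1 := fun h => hα' (Finset.mem_filter.2 ⟨hα, h⟩)
      rw [hzero α β (by omega), mul_zero]
    · have h1 := hle α (Finset.mem_filter.1 hα).1
      have h2 := hle β hβ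
      have h3 : β.degree ≠ t + 1 := fun h => hβ' (Finset.mem_filter.2 ⟨hβ, h⟩)
      rw [hzero α β (by omega), mul_zero]
  classical
  rw [hres, ← Finset.sum_fiberwise_of_maps_to (g := parity) (t := F.image parity)
    fun α hα => Finset.mem_image_of_mem _ hα]
  refine Finset.sum_nonneg fun a _ => ?_
  refine (sum_evenMoment_nonneg_of_parity ht hR hpsd (F.filter fun α => parity α = a) a
    (fun α hα => (Finset.mem_filter.1 (Finset.mem_filter.1 hα).1).2)
    (fun α hα => (Finset.mem_filter.1 hα).2) fun α => coeff α q).trans_eq ?_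
  refine Finset.sum_congr rfl fun α hα => Finset.sum_subset (Finset.filter_subset _ _)
    fun β hβ hβ' => ?_
  rw [hpar α β, mul_zero]
  rw [(Finset.mem_filter.1 hα).2]
  exact fun h => hβ' (Finset.mem_filter.2 ⟨hβ, h.symm⟩)

/-- Squares cannot cancel in top degree, so each base has degree at most `t + 1`. -/
theorem evenFunctional_nonneg_of_isSumSq (ht : 1 ≤ t) (hR : R ∈ boseSymmetric n (t + 1))
    (hpsd : ∀ s, s ≤ (t + 1) / 2 → (partialTranspose s R).PosSemidef)
    {p : MvPolynomial (Fin n) ℝ} (hp : IsSumSq p) (hdeg : p.totalDegree ≤ 2 * (t + 1)) :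
    0 ≤ evenFunctional R p := by
  induction hp with
  | zero => simp
  | sq_add q hs ih =>
    obtain ⟨h1, h2⟩ := totalDegree_mul_self_le (p := q) hs
    rw [map_add]
    refine add_nonneg (evenFunctional_mul_self_nonneg ht hR hpsd ?_) (ih (h2.trans hdeg))
    rcases eq_or_ne q 0 with rfl | hq
    · simp
    · have := totalDegree_mul_of_isDomain hq hq
      omega

end Moment

/-! ### The equivalence. -/

theorem totalDegree_sum_sq_pow_mul_quarticForm_le (A : Matrix (Fin n) (Fin n) ℝ) (r : ℕ) :
    ((∑ i, (X i : MvPolynomial (Fin n) ℝ) ^ 2) ^ r * quarticForm A).totalDegree ≤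
      2 * (r + 2) := by
  have hX : ∀ i : Fin n, ((X i : MvPolynomial (Fin n) ℝ) ^ 2).IsHomogeneous 2 := fun i => by
    simpa using (isHomogeneous_X ℝ i).pow 2
  have h1 : ((∑ i, (X i : MvPolynomial (Fin n) ℝ) ^ 2) ^ r).IsHomogeneous (2 * r) :=
    (IsHomogeneous.sum _ _ _ fun i _ => hX i).pow r
  have h2 : (quarticForm A).IsHomogeneous 4 :=
    IsHomogeneous.sum _ _ _ fun i _ => IsHomogeneous.sum _ _ _ fun j _ => by
      simpa using ((isHomogeneous_C (Fin n) (A i j)).mul (hX i)).mul (hX j)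
  exact (h1.mul h2).totalDegree_le.trans (by omega)

theorem mem_dualCone_dpsTilde_iff {S A : Matrix (Fin n) (Fin n) ℝ}
    {T : Matrix (Fin n) (Fin n) ℂ} (hT : T.IsHermitian) (hA : A.IsSymm)
    (hST : ∀ i j, A i j = (S i j + S j i) / 2 + (T i j).re) (r : ℕ) :
    partialTransposeB (M S T) ∈ dualCone (dpsTilde n (r + 1)) ↔ A ∈ coneK n r := by
  have hpair : ∀ R ∈ boseSymmetric n (r + 1 + 1), ∀ L : MvPolynomial (Fin n) ℝ →ₗ[ℝ] ℝ,
      (∀ i, L (monomial (weight i + weight i) 1) = (R i i).re) →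
      (Matrix.trace ((partialTransposeB (M S T)).conjTranspose *
        partialTrace (t := r + 1) R)).re =
        L ((∑ i, (X i : MvPolynomial (Fin n) ℝ) ^ 2) ^ r * quarticForm A) := by
    intro R hR L hL
    rw [trace_partialTransposeB_M_mul_partialTrace S hT hR,
      linearMap_sum_sq_pow_mul_quarticForm]
    simp only [hL, hST]
  constructor
  · rintro ⟨-, h⟩
    refine ⟨hA, by_contra fun hp => ?_⟩
    obtain ⟨L, hLp, R, hR, hpsd, hL⟩ := exists_separating_boseSymmetric hp (r + 1)
    have := h _ ⟨partialTrace_isHermitian hR.1, R, hR, fun s _ => hpsd s, rfl⟩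
    rw [hpair R hR L hL] at this
    exact hLp.not_ge this
  · rintro ⟨-, hp⟩
    refine ⟨isHermitian_partialTransposeB_M S hT, ?_⟩
    rintro _ ⟨-, R, hR, hpsd, rfl⟩
    rw [hpair R hR (evenFunctional R) fun i => by
      rw [evenFunctional_monomial, one_mul, evenMoment_weight_add_weight hR]]
    exact evenFunctional_nonneg_of_isSumSq (by omega) hR hpsd hp
      (totalDegree_sum_sq_pow_mul_quarticForm_le A r)

end SymDPS

theorem theorem4p5 (n : ℕ) :
    (∀ (S : Matrix (Fin n) (Fin n) ℝ) (T : Matrix (Fin n) (Fin n) ℂ), T.IsHermitian →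
      ∃ A : Matrix (Fin n) (Fin n) ℝ,
        A.IsSymm ∧
        A.map Complex.ofReal =
          (1 / 2 : ℂ) • (S.map Complex.ofReal + (S.map Complex.ofReal).transpose
            + T + T.transpose) ∧
        ∀ t : ℕ, 1 ≤ t →
          (SymDPS.partialTransposeB (SymDPS.M S T) ∈ SymDPS.dualCone (SymDPS.dpsTilde n t) ↔
            A ∈ SymDPS.coneK n (t - 1))) ∧
    (∀ A : Matrix (Fin n) (Fin n) ℝ, A.IsSymm → ∀ t : ℕ, 1 ≤ t →
      (SymDPS.partialTransposeB (SymDPS.M A 0) ∈ SymDPS.dualCone (SymDPS.dpsTilde n t) ↔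
        A ∈ SymDPS.coneK n (t - 1))) := by
  refine ⟨fun S T hT => ?_, fun A hA t ht => ?_⟩
  · have hre : ∀ i j, (T j i).re = (T i j).re := fun i j => by
      rw [← hT.apply i j]; simp
    have hsymm : (Matrix.of fun i j => (S i j + S j i) / 2 + (T i j).re).IsSymm := by
      ext i j
      simp [hre i j, add_comm (S j i)]
    refine ⟨_, hsymm, ?_, fun t ht => ?_⟩
    · ext i j
      -- Since `T` is Hermitian, `(T + Tᵀ) / 2` is its entrywise real part.
      have hsum : T i j + T j i = 2 * ((T i j).re : ℂ) := by
        rw [← hT.apply j i]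
        simpa using Complex.add_conj (T i j)
      simp only [Matrix.map_apply, Matrix.of_apply, Matrix.smul_apply, Matrix.add_apply,
        Matrix.transpose_apply, smul_eq_mul]
      rw [add_assoc _ (T i j), hsum]
      push_cast
      ring
    · obtain ⟨r, rfl⟩ := Nat.exists_eq_add_of_le' ht
      exact SymDPS.mem_dualCone_dpsTilde_iff hT hsymm (fun i j => rfl) r
  · obtain ⟨r, rfl⟩ := Nat.exists_eq_add_of_le' ht
    exact SymDPS.mem_dualCone_dpsTilde_iff Matrix.isHermitian_zero hA
      (fun i j => by simp [hA.apply i j]) r
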